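/- Let $\mathbb{F}$ be a perfect field of characteristic $p>0$. For a restricted Lie algebra $L$ over $\mathbb{F}$ with $p$-map $x\mapsto x^{[p]}$, let $u(L)$ denote its restricted enveloping algebra, that is, the quotient of the universal enveloping algebra of $L$ by the two-sided ideal generated by the elements $x^p-x^{[p]}$, $x\in L$, and let $L'_p$ denote the restricted subalgebra of $L$ generated by $L'=[L,L]$, i.e. the smallest Lie subalgebra containing $[L,L]$ and closed under the $p$-map; it is an ideal of $L$, so that $L/L'_p$ is again a restricted Lie algebra. Let $L$ be a finite-dimensional restricted Lie algebra over $\mathbb{F}$ that is $p$-nilpotent, i.e. there is an $n$ such that $x^{[p]^n}=0$ for all $x\in L$. Then $L/L'_p$ is determined by $u(L)$: if $H$ is any restricted Lie algebra over $\mathbb{F}$ such that $u(L)\cong u(H)$ as associative $\mathbb{F}$-algebras, then $L/L'_p\cong H/H'_p$ as restricted Lie algebras. -/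

import Mathlib

noncomputable section

/-- The `i`-th Jacobson term `s_i(x, y)`: `i • s_i(x, y)` is the coefficient of `T ^ (i - 1)` in
`(ad (T x + y)) ^ (p - 1) (x)`. Here `(ad (T x + y)) ^ (p - 1)` is computed as a polynomial in a
central variable `T` with coefficients in the ring of endomorphisms of `L`. -/
def jacobsonTerm (F : Type*) [Field F] (p : ℕ) {L : Type*} [LieRing L] [LieAlgebra F L]
    (i : ℕ) (x y : L) : L :=
  (i : F)⁻¹ •
    ((Polynomial.X * Polynomial.C (LieAlgebra.ad F L x : Module.End F L) +
      Polynomial.C (LieAlgebra.ad F L y : Module.End F L)) ^ (p - 1)).coeff (i - 1) x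

/-- A restricted Lie algebra over a field `F` (of characteristic `p`): a Lie algebra with a map
`x ↦ x^[p]` satisfying Jacobson's three axioms. -/
class RestrictedLieAlgebra (F : Type*) [Field F] (p : ℕ) (L : Type*) [LieRing L]
    [LieAlgebra F L] where
  /-- The `p`-map `x ↦ x^[p]`. -/
  pmap : L → L
  ad_pmap : ∀ x : L,
    (LieAlgebra.ad F L (pmap x) : Module.End F L) = (LieAlgebra.ad F L x : Module.End F L) ^ p
  pmap_smul : ∀ (a : F) (x : L), pmap (a • x) = a ^ p • pmap x
  pmap_add : ∀ x y : L,
    pmap (x + y) = pmap x + pmap y + ∑ i ∈ Finset.Icc 1 (p - 1), jacobsonTerm F p i x y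

namespace RestrictedLieAlgebra

/-- `L` is `p`-nilpotent: some iterate of the `p`-map is zero on all of `L`. -/
def IsPNilpotent (F : Type*) [Field F] (p : ℕ) (L : Type*) [LieRing L] [LieAlgebra F L]
    [RestrictedLieAlgebra F p L] : Prop :=
  ∃ n : ℕ, ∀ x : L, (pmap F p : L → L)^[n] x = 0

/-- The relations `x ^ p = x^[p]`, for `x` in `L`, on the universal enveloping algebra. -/
inductive EnvelopingRel (F : Type*) [Field F] (p : ℕ) (L : Type*) [LieRing L] [LieAlgebra F L]
    [RestrictedLieAlgebra F p L] :
    UniversalEnvelopingAlgebra F L → UniversalEnvelopingAlgebra F L → Prop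
  | pow (x : L) : EnvelopingRel F p L (UniversalEnvelopingAlgebra.ι F x ^ p)
      (UniversalEnvelopingAlgebra.ι F (pmap F p x))

/-- The restricted enveloping algebra `u(L)`: the quotient of the universal enveloping algebra by
the two-sided ideal generated by all `x ^ p - x^[p]`. -/
abbrev RestrictedEnvelopingAlgebra (F : Type*) [Field F] (p : ℕ) (L : Type*) [LieRing L]
    [LieAlgebra F L] [RestrictedLieAlgebra F p L] : Type _ :=
  RingQuot (EnvelopingRel F p L)

/-- A restricted ideal: a Lie ideal closed under the `p`-map. -/
class IsRestrictedIdeal (F : Type*) [Field F] (p : ℕ) {L : Type*} [LieRing L] [LieAlgebra F L]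
    [RestrictedLieAlgebra F p L] (I : LieIdeal F L) : Prop where
  pmap_mem : ∀ x ∈ I, pmap F p x ∈ I

/-- The restricted subalgebra of `L` generated by a set `S`: the intersection of all Lie
subalgebras that contain `S` and are closed under the `p`-map. -/
def restrictedClosure (F : Type*) [Field F] (p : ℕ) {L : Type*} [LieRing L] [LieAlgebra F L]
    [RestrictedLieAlgebra F p L] (S : Set L) : LieSubalgebra F L :=
  sInf {K : LieSubalgebra F L | S ⊆ K ∧ ∀ x ∈ K, pmap F p x ∈ K}

theorem mem_restrictedClosure (F : Type*) [Field F] (p : ℕ) {L : Type*} [LieRing L]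
    [LieAlgebra F L] [RestrictedLieAlgebra F p L] (S : Set L) (x : L) :
    x ∈ restrictedClosure F p S ↔
      ∀ K : LieSubalgebra F L, S ⊆ K → (∀ y ∈ K, pmap F p y ∈ K) → x ∈ K := by
  rw [restrictedClosure, ← SetLike.mem_coe, LieSubalgebra.coe_sInf]
  simp

theorem subset_restrictedClosure (F : Type*) [Field F] (p : ℕ) {L : Type*} [LieRing L]
    [LieAlgebra F L] [RestrictedLieAlgebra F p L] (S : Set L) :
    S ⊆ restrictedClosure F p S :=
  fun x hx => (mem_restrictedClosure F p S x).mpr fun _ hK _ => hK hx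

theorem pmap_mem_restrictedClosure (F : Type*) [Field F] (p : ℕ) {L : Type*} [LieRing L]
    [LieAlgebra F L] [RestrictedLieAlgebra F p L] (S : Set L) (x : L)
    (hx : x ∈ restrictedClosure F p S) : pmap F p x ∈ restrictedClosure F p S :=
  (mem_restrictedClosure F p S _).mpr fun K hK hK' =>
    hK' x ((mem_restrictedClosure F p S x).mp hx K hK hK')

/-- `L'_p`: the restricted subalgebra of `L` generated by `L' = [L, L]`. It contains `[L, L]`, hence
is an ideal. -/
def derivedP (F : Type*) [Field F] (p : ℕ) (L : Type*) [LieRing L] [LieAlgebra F L]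
    [RestrictedLieAlgebra F p L] : LieIdeal F L where
  __ := (restrictedClosure F p
    ((⁅(⊤ : LieIdeal F L), (⊤ : LieIdeal F L)⁆ : LieIdeal F L) : Set L)).toSubmodule
  lie_mem := by
    intro x m _
    exact subset_restrictedClosure F p _
      (LieSubmodule.lie_mem_lie (LieSubmodule.mem_top x) (LieSubmodule.mem_top m))

instance derivedP_isRestrictedIdeal (F : Type*) [Field F] (p : ℕ) (L : Type*) [LieRing L]
    [LieAlgebra F L] [RestrictedLieAlgebra F p L] : IsRestrictedIdeal F p (derivedP F p L) where
  pmap_mem x hx := pmap_mem_restrictedClosure F p _ x hx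

theorem coeff_mem (F : Type*) [Field F] {L : Type*} [LieRing L] [LieAlgebra F L]
    (I : LieIdeal F L) (x y : L) (hy : y ∈ I) (n i : ℕ) :
    ((Polynomial.X * Polynomial.C (LieAlgebra.ad F L x : Module.End F L) +
      Polynomial.C (LieAlgebra.ad F L y : Module.End F L)) ^ (n + 1)).coeff i x ∈ I := by
  induction n generalizing i with
  | zero =>
    cases i with
    | zero => simpa using lie_mem_left F L I y x hy
    | succ i =>
      cases i with
      | zero => simp
      | succ i => simp
  | succ n ih =>
    rw [pow_succ', add_mul, mul_assoc, Polynomial.coeff_add, LinearMap.add_apply]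
    refine I.add_mem ?_ ?_
    · cases i with
      | zero => simp
      | succ i =>
        rw [Polynomial.coeff_X_mul, Polynomial.coeff_C_mul]
        exact I.lie_mem (ih i)
    · rw [Polynomial.coeff_C_mul]
      exact I.lie_mem (ih i)

theorem jacobsonTerm_mem (F : Type*) [Field F] (p : ℕ) [Fact p.Prime] {L : Type*} [LieRing L]
    [LieAlgebra F L] (I : LieIdeal F L) (i : ℕ) (x y : L) (hy : y ∈ I) :
    jacobsonTerm F p i x y ∈ I := by
  obtain ⟨n, hn⟩ : ∃ n, p - 1 = n + 1 :=
    ⟨p - 2, by have := (Fact.out : p.Prime).two_le; omega⟩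
  unfold jacobsonTerm
  rw [hn]
  exact I.smul_mem _ (coeff_mem F I x y hy n (i - 1))

theorem map_coeff (F : Type*) [Field F] {L M : Type*} [LieRing L] [LieAlgebra F L]
    [LieRing M] [LieAlgebra F M] (f : L →ₗ⁅F⁆ M) (x y : L) (n i : ℕ) :
    f (((Polynomial.X * Polynomial.C (LieAlgebra.ad F L x : Module.End F L) +
      Polynomial.C (LieAlgebra.ad F L y : Module.End F L)) ^ n).coeff i x) =
    ((Polynomial.X * Polynomial.C (LieAlgebra.ad F M (f x) : Module.End F M) +
      Polynomial.C (LieAlgebra.ad F M (f y) : Module.End F M)) ^ n).coeff i (f x) := by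
  induction n generalizing i with
  | zero => by_cases h : i = 0 <;> simp [Polynomial.coeff_one, h]
  | succ n ih =>
    rw [pow_succ', pow_succ', add_mul, add_mul, mul_assoc, mul_assoc, Polynomial.coeff_add,
      Polynomial.coeff_add, LinearMap.add_apply, LinearMap.add_apply, map_add]
    congr 1
    · cases i with
      | zero => simp
      | succ i =>
        rw [Polynomial.coeff_X_mul, Polynomial.coeff_C_mul, Polynomial.coeff_X_mul,
          Polynomial.coeff_C_mul]
        simp only [Module.End.mul_apply, LieAlgebra.ad_apply, LieHom.map_lie, ih]
    · rw [Polynomial.coeff_C_mul, Polynomial.coeff_C_mul]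
      simp only [Module.End.mul_apply, LieAlgebra.ad_apply, LieHom.map_lie, ih]

theorem map_jacobsonTerm (F : Type*) [Field F] (p : ℕ) {L M : Type*} [LieRing L] [LieAlgebra F L]
    [LieRing M] [LieAlgebra F M] (f : L →ₗ⁅F⁆ M) (i : ℕ) (x y : L) :
    f (jacobsonTerm F p i x y) = jacobsonTerm F p i (f x) (f y) := by
  simp only [jacobsonTerm, map_smul, map_coeff]

/-- The `p`-map `x + I ↦ x^[p] + I` on the quotient by a restricted ideal. -/
def quotientPMap (F : Type*) [Field F] (p : ℕ) [Fact p.Prime] {L : Type*} [LieRing L]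
    [LieAlgebra F L] [RestrictedLieAlgebra F p L] (I : LieIdeal F L) [IsRestrictedIdeal F p I] :
    L ⧸ I → L ⧸ I :=
  fun q => Quotient.liftOn' q (fun x => (LieSubmodule.Quotient.mk (pmap F p x) : L ⧸ I)) (by
    intro x y hxy
    have h : -x + y ∈ I := (QuotientAddGroup.leftRel_apply).mp hxy
    refine ((Submodule.Quotient.eq I.toSubmodule).mpr ?_).symm
    have hy : y = x + (-x + y) := by abel
    rw [hy, pmap_add, add_assoc, add_sub_cancel_left]
    exact I.add_mem (IsRestrictedIdeal.pmap_mem _ h)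
      (I.toSubmodule.sum_mem fun i _ => jacobsonTerm_mem F p I i x _ h))

theorem quotientPMap_mk (F : Type*) [Field F] (p : ℕ) [Fact p.Prime] {L : Type*} [LieRing L]
    [LieAlgebra F L] [RestrictedLieAlgebra F p L] (I : LieIdeal F L) [IsRestrictedIdeal F p I]
    (x : L) : quotientPMap F p I (LieSubmodule.Quotient.mk' I x) =
      LieSubmodule.Quotient.mk' I (pmap F p x) := rfl

/-- The canonical projection to the quotient by an ideal, as a Lie algebra homomorphism. -/
def quotientHom (F : Type*) [Field F] {L : Type*} [LieRing L] [LieAlgebra F L]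
    (I : LieIdeal F L) : L →ₗ⁅F⁆ L ⧸ I where
  __ := (LieSubmodule.Quotient.mk' I : L →ₗ[F] L ⧸ I)
  map_lie' := by intro x y; exact LieSubmodule.Quotient.mk_bracket I x y

/-- The restricted Lie algebra structure on the quotient by a restricted ideal. -/
instance quotientRestricted (F : Type*) [Field F] (p : ℕ) [Fact p.Prime] {L : Type*} [LieRing L]
    [LieAlgebra F L] [RestrictedLieAlgebra F p L] (I : LieIdeal F L) [IsRestrictedIdeal F p I] :
    RestrictedLieAlgebra F p (L ⧸ I) where
  pmap := quotientPMap F p I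
  ad_pmap := by
    intro q
    obtain ⟨x, rfl⟩ : ∃ x, quotientHom F I x = q := LieSubmodule.Quotient.surjective_mk' I q
    refine LinearMap.ext fun r => ?_
    obtain ⟨y, rfl⟩ : ∃ y, quotientHom F I y = r := LieSubmodule.Quotient.surjective_mk' I r
    have h1 : quotientPMap F p I (quotientHom F I x) = quotientHom F I (pmap F p x) := rfl
    have h2 : ∀ n : ℕ, ((LieAlgebra.ad F (L ⧸ I) (quotientHom F I x) : Module.End F (L ⧸ I)) ^ n)
        (quotientHom F I y) =
        quotientHom F I (((LieAlgebra.ad F L x : Module.End F L) ^ n) y) := by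
      intro n
      induction n with
      | zero => simp
      | succ n ih =>
        rw [pow_succ', pow_succ', Module.End.mul_apply, Module.End.mul_apply, ih,
          LieAlgebra.ad_apply, LieAlgebra.ad_apply, LieHom.map_lie]
    rw [h1, h2, ← ad_pmap, LieAlgebra.ad_apply, LieAlgebra.ad_apply, LieHom.map_lie]
  pmap_smul := by
    intro a q
    obtain ⟨x, rfl⟩ : ∃ x, quotientHom F I x = q := LieSubmodule.Quotient.surjective_mk' I q
    have h1 : ∀ z, quotientPMap F p I (quotientHom F I z) = quotientHom F I (pmap F p z) :=
      fun _ => rfl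
    rw [← map_smul, h1, h1, pmap_smul, map_smul]
  pmap_add := by
    intro q r
    obtain ⟨x, rfl⟩ : ∃ x, quotientHom F I x = q := LieSubmodule.Quotient.surjective_mk' I q
    obtain ⟨y, rfl⟩ : ∃ y, quotientHom F I y = r := LieSubmodule.Quotient.surjective_mk' I r
    have h1 : ∀ z, quotientPMap F p I (quotientHom F I z) = quotientHom F I (pmap F p z) :=
      fun _ => rfl
    rw [← map_add, h1, h1, h1, pmap_add, map_add, map_add, map_sum]
    simp only [map_jacobsonTerm]

end RestrictedLieAlgebra

end

/-! The largest commutative quotient of `u(L)` depends only on the algebra `u(L)`. By universal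
properties it is the algebra `A(t) = Sym(V)/(x^p - t x)`, where `V = L/L'_p` and `t` is its `p`-map,
which is Frobenius-semilinear because `V` is abelian. So it is enough to recover `(V, t)` from
`A(t)` when `V` is finite-dimensional and `t` is nilpotent.

Given `φ : A(t) ≃ A(s)`, with `s` acting on `W`, finiteness of `W` and nilpotency of `s` follow from
those of `V` and `t`; the first uses that `W` embeds in `A(s)` (`ι_injective`). The main tool is
`extends_id`: a linear retraction `π : A(s) → W` with `π(y^p) = s(π y)` that sends products of two
nilpotents into the range of `s`. Over a perfect field `(W, s)` splits into chains `v, s v, ..., s^m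
v`. Each chain is handled through `F[X]/(X^(p^(m+1)))`, by sending `X^(p^k)` to `s^k v` and every
other monomial to zero.

Then `f = π ∘ φ ∘ ι` intertwines `t` and `s`. Since `A(t) = F + ι(V) + N²`, with `N` the nilradical,
every `w` lies in `f(V) + s(W)`; nilpotency of `s` makes `f` surjective. The same argument for the
inverse of `φ` gives equal dimensions, so `f` is an isomorphism. -/

noncomputable section

/-! ### Deforming the monomial basis: linear forms modulo `X j ^ p - l j` -/

open MvPolynomial in
/-- The product of `X j ^ (c j % p) * (X j ^ p - l j) ^ (c j / p)`: a deformation of the monomial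
with exponent `c`. -/
def deformedMonomial {J F : Type*} [CommRing F] (p : ℕ) (l : J → MvPolynomial J F)
    (c : J →₀ ℕ) : MvPolynomial J F :=
  c.prod fun j k => X j ^ (k % p) * (X j ^ p - l j) ^ (k / p)

namespace MvPolynomial

variable {J F : Type*} [CommRing F]

/-- The polynomials all of whose monomials have degree less than `n`. -/
def degreeLT (J F : Type*) [CommRing F] (n : ℕ) : Submodule F (MvPolynomial J F) :=
  restrictSupport F {d | d.degree < n}

theorem mem_degreeLT {n : ℕ} {f : MvPolynomial J F} :
    f ∈ degreeLT J F n ↔ ∀ d ∈ f.support, d.degree < n := by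
  rw [degreeLT, mem_restrictSupport_iff]
  rfl

theorem degreeLT_mono {m n : ℕ} (h : m ≤ n) : degreeLT J F m ≤ degreeLT J F n := fun f hf => by
  rw [mem_degreeLT] at *
  exact fun d hd => (hf d hd).trans_le h

theorem exists_mem_degreeLT (f : MvPolynomial J F) : ∃ n, f ∈ degreeLT J F n := by
  refine ⟨f.totalDegree + 1, mem_degreeLT.mpr fun d hd => Nat.lt_succ_of_le ?_⟩
  exact le_totalDegree hd

theorem eq_zero_of_mem_degreeLT_zero {f : MvPolynomial J F} (hf : f ∈ degreeLT J F 0) :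
    f = 0 := by
  rw [mem_degreeLT] at hf
  rw [← support_eq_empty, Finset.eq_empty_iff_forall_notMem]
  exact fun d hd => absurd (hf d hd) (Nat.not_lt_zero _)

/-- One bound is strict and the other is not, so that lower-order errors stay lower-order after
multiplication, with no truncated subtraction. -/
theorem mul_mem_degreeLT {m n : ℕ} {f g : MvPolynomial J F} (hf : f ∈ degreeLT J F m)
    (hg : g ∈ degreeLT J F (n + 1)) : f * g ∈ degreeLT J F (m + n) := by
  classical
  rw [mem_degreeLT] at *
  intro d hd
  obtain ⟨a, ha, b, hb, rfl⟩ := Finset.mem_add.mp (support_mul f g hd)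
  have h1 := hf a ha
  have h2 := hg b hb
  rw [map_add]
  omega

/-- `f` and `g` have degree at most `n` and the same homogeneous component of degree `n`. -/
def SameTop (n : ℕ) (f g : MvPolynomial J F) : Prop :=
  f ∈ degreeLT J F (n + 1) ∧ g ∈ degreeLT J F (n + 1) ∧ f - g ∈ degreeLT J F n

theorem SameTop.mul {m n : ℕ} {f g f' g' : MvPolynomial J F} (h : SameTop m f g)
    (h' : SameTop n f' g') : SameTop (m + n) (f * f') (g * g') := by
  refine ⟨?_, ?_, ?_⟩
  · rw [add_right_comm]
    exact mul_mem_degreeLT h.1 h'.1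
  · rw [add_right_comm]
    exact mul_mem_degreeLT h.2.1 h'.2.1
  · have e : f * f' - g * g' = (f - g) * f' + (f' - g') * g := by ring
    rw [e]
    refine Submodule.add_mem _ (mul_mem_degreeLT h.2.2 h'.1) ?_
    rw [add_comm m]
    exact mul_mem_degreeLT h'.2.2 h.2.1

theorem SameTop.one : SameTop 0 (1 : MvPolynomial J F) 1 := by
  classical
  have : (1 : MvPolynomial J F) ∈ degreeLT J F (0 + 1) := by
    rw [mem_degreeLT]
    intro d hd
    rw [mem_support_iff, coeff_one] at hd
    have : 0 = d := by
      by_contra h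
      simp [h] at hd
    simp [← this]
  exact ⟨this, this, by simp⟩

theorem SameTop.pow {n : ℕ} {f g : MvPolynomial J F} (h : SameTop n f g) (k : ℕ) :
    SameTop (k * n) (f ^ k) (g ^ k) := by
  induction k with
  | zero => simpa using SameTop.one
  | succ k ih =>
    rw [pow_succ, pow_succ, add_mul, one_mul]
    exact ih.mul h

theorem SameTop.prod {ι : Type*} (s : Finset ι) (n : ι → ℕ) (f g : ι → MvPolynomial J F)
    (h : ∀ i ∈ s, SameTop (n i) (f i) (g i)) :
    SameTop (∑ i ∈ s, n i) (∏ i ∈ s, f i) (∏ i ∈ s, g i) := by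
  classical
  induction s using Finset.induction_on with
  | empty => simpa using SameTop.one
  | insert a s ha ih =>
    rw [Finset.sum_insert ha, Finset.prod_insert ha, Finset.prod_insert ha]
    exact (h a (Finset.mem_insert_self a s)).mul
      (ih fun i hi => h i (Finset.mem_insert_of_mem hi))

theorem X_mem_degreeLT (j : J) : (X j : MvPolynomial J F) ∈ degreeLT J F (1 + 1) := by
  rw [mem_degreeLT]
  intro d hd
  have := support_monomial_subset hd
  rw [Finset.mem_singleton] at this
  simp [this]

theorem SameTop.X (j : J) : SameTop 1 (X j : MvPolynomial J F) (X j) :=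
  ⟨X_mem_degreeLT j, X_mem_degreeLT j, by simp⟩

theorem SameTop.sub_right {n : ℕ} {f l : MvPolynomial J F} (hf : f ∈ degreeLT J F (n + 1))
    (hl : l ∈ degreeLT J F n) : SameTop n (f - l) f := by
  refine ⟨Submodule.sub_mem _ hf (degreeLT_mono n.le_succ hl), hf, ?_⟩
  have : f - l - f = -l := by ring
  rw [this]
  exact Submodule.neg_mem _ hl

variable (p : ℕ) (l : J → MvPolynomial J F)

theorem sameTop_deformed_pow (hl : ∀ j, l j ∈ degreeLT J F p) (j : J) (k : ℕ) :
    SameTop k (X j ^ (k % p) * (X j ^ p - l j) ^ (k / p)) (X j ^ k) := by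
  have hX : ∀ m, SameTop m (X j ^ m : MvPolynomial J F) (X j ^ m) := fun m => by
    have := (SameTop.X (F := F) j).pow m
    rwa [mul_one] at this
  have h : SameTop (k % p + k / p * p) (X j ^ (k % p) * (X j ^ p - l j) ^ (k / p))
      (X j ^ (k % p) * (X j ^ p) ^ (k / p)) :=
    (hX _).mul (SameTop.pow (SameTop.sub_right (hX p).1 (hl j)) _)
  rwa [← pow_mul, ← pow_add, Nat.mod_add_div, mul_comm (k / p), Nat.mod_add_div] at h

theorem sameTop_deformedMonomial (hl : ∀ j, l j ∈ degreeLT J F p) (c : J →₀ ℕ) :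
    SameTop c.degree (deformedMonomial p l c) (monomial c 1) := by
  rw [monomial_eq, C_1, one_mul, Finsupp.degree_apply]
  exact SameTop.prod _ _ _ _ fun j _ => sameTop_deformed_pow p l hl j (c j)

/-- The linear map that sends each monomial to its deformation. -/
def deform : MvPolynomial J F →ₗ[F] MvPolynomial J F :=
  (basisMonomials J F).constr F (deformedMonomial p l)

theorem deform_monomial (c : J →₀ ℕ) :
    deform p l (monomial c 1) = deformedMonomial p l c := by
  have h : monomial c (1 : F) = basisMonomials J F c := by rw [coe_basisMonomials]
  rw [h, deform, Module.Basis.constr_basis]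

/-- This is unitriangularity for the degree filtration; bijectivity of `deform` follows by descent
on the degree. -/
theorem deform_sub_self_mem (hl : ∀ j, l j ∈ degreeLT J F p) {n : ℕ} {f : MvPolynomial J F}
    (hf : f ∈ degreeLT J F (n + 1)) : deform p l f - f ∈ degreeLT J F n := by
  rw [mem_degreeLT] at hf
  have e : deform p l f - f = ∑ c ∈ f.support,
      coeff c f • (deformedMonomial p l c - monomial c 1) := by
    conv_lhs => rw [f.as_sum]
    rw [map_sum, ← Finset.sum_sub_distrib]
    refine Finset.sum_congr rfl fun c _ => ?_
    have : monomial c (coeff c f) = coeff c f • monomial c (1 : F) := by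
      rw [smul_monomial, smul_eq_mul, mul_one]
    rw [this, map_smul, deform_monomial, smul_sub]
  rw [e]
  refine Submodule.sum_mem _ fun c hc => Submodule.smul_mem _ _ ?_
  exact degreeLT_mono (Nat.le_of_lt_succ (hf c hc)) (sameTop_deformedMonomial p l hl c).2.2

theorem deform_injective (hl : ∀ j, l j ∈ degreeLT J F p) :
    Function.Injective (deform p l) := by
  rw [injective_iff_map_eq_zero]
  intro f hf
  have key : ∀ n, f ∈ degreeLT J F n → f ∈ degreeLT J F 0 := by
    intro n
    induction n with
    | zero => exact id
    | succ n ih =>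
      intro h
      have := deform_sub_self_mem p l hl h
      rw [hf, zero_sub, Submodule.neg_mem_iff] at this
      exact ih this
  obtain ⟨n, hn⟩ := exists_mem_degreeLT f
  exact eq_zero_of_mem_degreeLT_zero (key n hn)

theorem deform_surjective (hl : ∀ j, l j ∈ degreeLT J F p) :
    Function.Surjective (deform p l) := by
  have key : ∀ n, ∀ f ∈ degreeLT J F n, ∃ g, deform p l g = f := by
    intro n
    induction n with
    | zero => exact fun f hf => ⟨0, by rw [eq_zero_of_mem_degreeLT_zero hf, map_zero]⟩
    | succ n ih =>
      intro f hf
      obtain ⟨g, hg⟩ := ih _ (deform_sub_self_mem p l hl hf)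
      exact ⟨f - g, by rw [map_sub, hg, sub_sub_cancel]⟩
  intro f
  obtain ⟨n, hn⟩ := exists_mem_degreeLT f
  exact key n f hn

/-- Adding `p` to an exponent keeps its remainder and raises its quotient by one. Hence `deform`
turns multiplication by `X j ^ p` into multiplication by `X j ^ p - l j`, and so matches the two
ideals. -/
theorem deformedMonomial_add_single (hp : 0 < p) (c : J →₀ ℕ) (j : J) :
    deformedMonomial p l (c + Finsupp.single j p) =
      (X j ^ p - l j) * deformedMonomial p l c := by
  classical
  unfold deformedMonomial
  rw [← Finsupp.mul_prod_erase' (c + Finsupp.single j p) j _ (by simp),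
    ← Finsupp.mul_prod_erase' c j _ (by simp)]
  have h : (c + Finsupp.single j p).erase j = c.erase j := by
    ext i
    by_cases hi : i = j
    · simp [hi]
    · simp [hi, Finsupp.erase_ne]
  rw [h, Finsupp.add_apply, Finsupp.single_eq_same, Nat.add_mod_right, Nat.add_div_right _ hp,
    pow_succ]
  ring

theorem deform_X_pow_mul (hp : 0 < p) (j : J) (f : MvPolynomial J F) :
    deform p l (X j ^ p * f) = (X j ^ p - l j) * deform p l f := by
  have h : deform p l ∘ₗ LinearMap.mulLeft F (X j ^ p) =
      LinearMap.mulLeft F (X j ^ p - l j) ∘ₗ deform p l := by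
    refine (basisMonomials J F).ext fun c => ?_
    rw [coe_basisMonomials, LinearMap.comp_apply, LinearMap.comp_apply, LinearMap.mulLeft_apply,
      LinearMap.mulLeft_apply, X_pow_eq_monomial, monomial_mul, one_mul, add_comm,
      deform_monomial, deform_monomial, deformedMonomial_add_single p l hp, X_pow_eq_monomial]
  exact LinearMap.congr_fun h f

theorem deform_X (hp : 1 < p) (j : J) : deform p l (X j) = X j := by
  rw [X, deform_monomial, deformedMonomial, Finsupp.prod_single_index (by simp),
    Nat.mod_eq_of_lt hp, Nat.div_eq_of_lt hp, pow_one, pow_zero, mul_one]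
  rfl

theorem exists_deform_eq_of_mem_span (hp : 0 < p) (hl : ∀ j, l j ∈ degreeLT J F p)
    {f : MvPolynomial J F} (hf : f ∈ Ideal.span (Set.range fun j => X j ^ p - l j)) :
    ∃ g ∈ Ideal.span (Set.range fun j => (X j ^ p : MvPolynomial J F)), deform p l g = f := by
  induction hf using Submodule.closure_induction with
  | smul_mem a x hx =>
    obtain ⟨j, rfl⟩ := hx
    obtain ⟨g, hg⟩ := deform_surjective p l hl a
    refine ⟨X j ^ p * g, Ideal.mul_mem_right _ _ (Ideal.subset_span ⟨j, rfl⟩), ?_⟩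
    rw [deform_X_pow_mul p l hp, hg, smul_eq_mul, mul_comm]
  | zero => exact ⟨0, Submodule.zero_mem _, map_zero _⟩
  | add x y _ _ hx hy =>
    obtain ⟨g, hg, rfl⟩ := hx
    obtain ⟨h, hh, rfl⟩ := hy
    exact ⟨g + h, Submodule.add_mem _ hg hh, map_add _ _ _⟩

/-- A linear form in the ideal generated by the `X j ^ p - l j`, where `l j` has degree less than
`p`, is zero. -/
theorem linear_eq_zero_of_mem_span (hp : 1 < p) (hl : ∀ j, l j ∈ degreeLT J F p) (b : J →₀ F)
    (hb : (b.sum fun j a => a • (X j : MvPolynomial J F)) ∈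
      Ideal.span (Set.range fun j => X j ^ p - l j)) : b = 0 := by
  classical
  obtain ⟨g, hg, hgb⟩ := exists_deform_eq_of_mem_span p l (by omega) hl hb
  have hd : deform p l (b.sum fun j a => a • (X j : MvPolynomial J F)) =
      b.sum fun j a => a • (X j : MvPolynomial J F) := by
    rw [Finsupp.sum, map_sum]
    exact Finset.sum_congr rfl fun j _ => by rw [map_smul, deform_X p l hp]
  have hgb' := deform_injective p l hl (hgb.trans hd.symm)
  ext j
  by_contra hj
  have hs : (Set.range fun j => (X j ^ p : MvPolynomial J F)) =
      (fun s => monomial s (1 : F)) '' Set.range fun j => Finsupp.single j p := by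
    rw [← Set.range_comp]
    refine congrArg Set.range (_root_.funext fun i => ?_)
    rw [X_pow_eq_monomial, Function.comp_apply]
  rw [hs, mem_ideal_span_monomial_image] at hg
  have hc : coeff (Finsupp.single j 1) g = b j := by
    rw [hgb', Finsupp.sum, coeff_sum, Finset.sum_eq_single j]
    · simp
    · intro i _ hi
      rw [coeff_smul, coeff_X, if_neg, smul_zero]
      exact fun h => hi ((Finsupp.single_left_inj one_ne_zero).mp h)
    · intro h
      simp [Finsupp.notMem_support_iff.mp h]
  -- The monomial `X j` would have to be divisible by some `X i ^ p`, which is impossible as `p >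
  -- 1`.
  obtain ⟨_, ⟨i, rfl⟩, hi⟩ := hg (Finsupp.single j 1) (by rw [mem_support_iff, hc]; exact hj)
  have h1 := hi i
  rw [Finsupp.single_eq_same, Finsupp.single_apply] at h1
  split_ifs at h1 <;> omega

end MvPolynomial

/-! ### The universal commutative algebra of a Frobenius-semilinear map -/

section FrobeniusEnvelope

variable {F : Type*} [Field F] {p : ℕ} [Fact p.Prime] [CharP F p]
variable {V : Type*} [AddCommGroup V] [Module F V]

/-- The universal commutative algebra over a vector space `V` in which `x ^ p = t x` for a
Frobenius-semilinear map `t`. -/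
abbrev FrobeniusEnvelope (t : V →ₛₗ[frobenius F p] V) : Type _ :=
  SymmetricAlgebra F V ⧸ Ideal.span (Set.range fun x : V =>
    SymmetricAlgebra.ι F V x ^ p - SymmetricAlgebra.ι F V (t x))

namespace FrobeniusEnvelope

variable (t : V →ₛₗ[frobenius F p] V)

/-- The canonical map to the universal algebra. -/
def ι : V →ₗ[F] FrobeniusEnvelope t :=
  (Ideal.Quotient.mkₐ F _).toLinearMap ∘ₗ SymmetricAlgebra.ι F V

theorem ι_pow (x : V) : ι t x ^ p = ι t (t x) :=
  (Ideal.Quotient.eq (I := Ideal.span (Set.range fun x : V =>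
    SymmetricAlgebra.ι F V x ^ p - SymmetricAlgebra.ι F V (t x)))
    (x := SymmetricAlgebra.ι F V x ^ p)).mpr (Ideal.subset_span ⟨x, rfl⟩)

theorem ι_iterate_pow (n : ℕ) (x : V) : ι t x ^ p ^ n = ι t (t^[n] x) := by
  induction n generalizing x with
  | zero => simp
  | succ n ih => rw [pow_succ', pow_mul, ι_pow, ih, Function.iterate_succ_apply]

variable {C : Type*} [CommRing C] [Algebra F C]

/-- The universal property. -/
def lift (g : V →ₗ[F] C) (hg : ∀ x, g (t x) = g x ^ p) : FrobeniusEnvelope t →ₐ[F] C :=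
  Ideal.Quotient.liftₐ _ (SymmetricAlgebra.lift g) fun a ha => by
    rw [← RingHom.mem_ker]
    refine (Ideal.span_le.mpr ?_ : _ ≤ RingHom.ker (SymmetricAlgebra.lift g)) ha
    rintro _ ⟨x, rfl⟩
    rw [SetLike.mem_coe, RingHom.mem_ker, map_sub, map_pow, SymmetricAlgebra.lift_ι_apply,
      SymmetricAlgebra.lift_ι_apply, hg, sub_self]

@[simp]
theorem lift_ι (g : V →ₗ[F] C) (hg : ∀ x, g (t x) = g x ^ p) (x : V) :
    lift t g hg (ι t x) = g x :=
  SymmetricAlgebra.lift_ι_apply g x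

theorem algHom_ext {f g : FrobeniusEnvelope t →ₐ[F] C} (h : ∀ x, f (ι t x) = g (ι t x)) :
    f = g := by
  refine Ideal.Quotient.algHom_ext _ (SymmetricAlgebra.algHom_ext (LinearMap.ext fun x => ?_))
  exact h x

/-- The universal property gives a map to the generated subalgebra whose composite with the
inclusion is the identity. -/
theorem adjoin_range_ι : Algebra.adjoin F (Set.range (ι t)) = ⊤ := by
  let S := Algebra.adjoin F (Set.range (ι t))
  let j : V →ₗ[F] S :=
    (ι t).codRestrict (Subalgebra.toSubmodule S) fun x => Algebra.subset_adjoin ⟨x, rfl⟩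
  have hj : ∀ x, j (t x) = j x ^ p := fun x => Subtype.ext (ι_pow t x).symm
  let g : FrobeniusEnvelope t →ₐ[F] S := lift t j hj
  have h : S.val.comp g = AlgHom.id F _ :=
    algHom_ext t fun x => congrArg S.val (lift_ι t j hj x)
  refine eq_top_iff.mpr fun y _ => ?_
  have hy : (g y : FrobeniusEnvelope t) = y := AlgHom.congr_fun h y
  exact hy ▸ (g y).2

/-- In coordinates the relations become `X j ^ p = l j` with `l j` a linear form, of degree less
than `p`, so `linear_eq_zero_of_mem_span` applies. -/
theorem ι_injective : Function.Injective (ι t) := by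
  classical
  let b := Module.Basis.ofVectorSpace F V
  let q : V →ₗ[F] MvPolynomial (Module.Basis.ofVectorSpaceIndex F V) F :=
    b.constr F MvPolynomial.X
  have hq : ∀ x, q x = (b.repr x).sum fun j a => a • MvPolynomial.X j := fun x =>
    b.constr_apply _ _ _
  let I := Ideal.span (Set.range fun j => MvPolynomial.X j ^ p - q (t (b j)))
  have hp : 1 < p := (Fact.out : p.Prime).one_lt
  -- Both terms are Frobenius-semilinear in `x`, so the relations for basis vectors imply all the
  -- others.
  have hI : ∀ x, q x ^ p - q (t x) ∈ I := by
    intro x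
    have h1 : q x ^ p = ∑ j ∈ (b.repr x).support, (b.repr x j) ^ p • MvPolynomial.X j ^ p := by
      rw [hq, Finsupp.sum, sum_pow_char]
      exact Finset.sum_congr rfl fun j _ => smul_pow _ _ _
    have h2 : q (t x) = ∑ j ∈ (b.repr x).support, (b.repr x j) ^ p • q (t (b j)) := by
      conv_lhs => rw [← b.linearCombination_repr x]
      rw [Finsupp.linearCombination_apply, Finsupp.sum, map_sum, map_sum]
      exact Finset.sum_congr rfl fun j _ => by
        rw [map_smulₛₗ, map_smul, frobenius_def]
    rw [h1, h2, ← Finset.sum_sub_distrib]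
    refine Ideal.sum_mem _ fun j _ => ?_
    rw [← smul_sub, Algebra.smul_def]
    exact Ideal.mul_mem_left _ _ (Ideal.subset_span ⟨j, rfl⟩)
  let g : FrobeniusEnvelope t →ₐ[F] MvPolynomial (Module.Basis.ofVectorSpaceIndex F V) F ⧸ I :=
    lift t ((Ideal.Quotient.mkₐ F I).toLinearMap ∘ₗ q) fun x =>
      (Ideal.Quotient.eq.mpr (hI x)).symm
  rw [injective_iff_map_eq_zero]
  intro x hx
  have h0 : g (ι t x) = 0 := by rw [hx, map_zero]
  have hx' : Ideal.Quotient.mk I (q x) = 0 := by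
    rw [← h0]
    exact (lift_ι t ((Ideal.Quotient.mkₐ F I).toLinearMap ∘ₗ q) _ x).symm
  rw [Ideal.Quotient.eq_zero_iff_mem, hq] at hx'
  have hl : ∀ j, q (t (b j)) ∈ MvPolynomial.degreeLT (Module.Basis.ofVectorSpaceIndex F V) F p := by
    intro j
    rw [hq]
    refine Submodule.sum_mem _ fun i _ => Submodule.smul_mem _ _ ?_
    exact MvPolynomial.degreeLT_mono hp (MvPolynomial.X_mem_degreeLT i)
  exact b.repr.map_eq_zero_iff.mp (MvPolynomial.linear_eq_zero_of_mem_span p _ hp hl _ hx')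

end FrobeniusEnvelope

end FrobeniusEnvelope

/-! ### Chains `v, t v, ..., t^m v` and additive polynomials -/

section Chain

variable {F : Type*} [Field F] {p : ℕ} [Fact p.Prime] [CharP F p]
variable {V : Type*} [AddCommGroup V] [Module F V] (t : V →ₛₗ[frobenius F p] V)

theorem iterate_frobenius_semilinear_smul (k : ℕ) (a : F) (x : V) :
    t^[k] (a • x) = a ^ p ^ k • t^[k] x := by
  induction k with
  | zero => simp
  | succ k ih =>
    rw [Function.iterate_succ_apply', Function.iterate_succ_apply', ih, map_smulₛₗ, frobenius_def,
      ← pow_mul, ← pow_succ]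

/-- The later members of the chain are killed by `t^[m]` and `v` is not, so `v` is outside their
span; induct on the chain of `t v`. -/
theorem linearIndependent_iterate (m : ℕ) (v : V) (h : t^[m] v ≠ 0) (h' : t^[m + 1] v = 0) :
    LinearIndependent F fun j : Fin (m + 1) => t^[j] v := by
  induction m generalizing v with
  | zero =>
    have : Subsingleton (Fin (0 + 1)) := inferInstanceAs (Subsingleton (Fin 1))
    exact LinearIndependent.of_subsingleton (0 : Fin (0 + 1)) h
  | succ m ih =>
    rw [linearIndependent_finSucc]
    refine ⟨?_, ?_⟩
    · exact ih (t v) h h'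
    · intro hv
      refine h ?_
      refine Submodule.span_induction (p := fun x _ => t^[m + 1] x = 0) ?_ ?_ ?_ ?_ hv
      · rintro _ ⟨j, rfl⟩
        change t^[m + 1] (t^[j.1 + 1] v) = 0
        rw [← Function.iterate_add_apply, show m + 1 + (j.1 + 1) = j.1 + (m + 1 + 1) by omega,
          Function.iterate_add_apply, h', iterate_map_zero]
      · exact iterate_map_zero t _
      · intro x y _ _ hx hy
        rw [iterate_map_add, hx, hy, add_zero]
      · intro a x _ hx
        rw [iterate_frobenius_semilinear_smul, hx, smul_zero]

theorem exists_dual_iterate (m : ℕ) (v : V) (h : t^[m] v ≠ 0) (h' : t^[m + 1] v = 0) :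
    ∃ f : V →ₗ[F] F, f (t^[m] v) = 1 ∧ ∀ j < m, f (t^[j] v) = 0 := by
  have hli := linearIndependent_iterate t m v h h'
  obtain ⟨f, hf⟩ := LinearMap.exists_extend (Finsupp.lapply (Fin.last m) ∘ₗ hli.repr)
  have key : ∀ j : Fin (m + 1), f (t^[j] v) = Finsupp.single j (1 : F) (Fin.last m) := fun j => by
    rw [← hli.repr_eq_single j ⟨_, Submodule.subset_span ⟨j, rfl⟩⟩ rfl]
    exact LinearMap.congr_fun hf ⟨t^[j] v, Submodule.subset_span ⟨j, rfl⟩⟩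
  refine ⟨f, by simpa using key (Fin.last m), fun j hj => ?_⟩
  have := key ⟨j, hj.trans m.lt_succ_self⟩
  rwa [Finsupp.single_eq_of_ne] at this
  exact fun e => hj.ne' (congrArg Fin.val e)

open Polynomial

/-- The linear map from polynomials to `V` that sends `X ^ p ^ k` to `t^[k] v` for `k < n`, and all
other monomials to zero. -/
def chainEval (n : ℕ) (v : V) : F[X] →ₗ[F] V :=
  ∑ k ∈ Finset.range n, (lcoeff F (p ^ k)).smulRight (t^[k] v)

theorem chainEval_apply (n : ℕ) (v : V) (f : F[X]) :
    chainEval t n v f = ∑ k ∈ Finset.range n, f.coeff (p ^ k) • t^[k] v := by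
  simp [chainEval]

theorem coeff_pow_char (f : F[X]) (k : ℕ) : (f ^ p).coeff (p ^ (k + 1)) = f.coeff (p ^ k) ^ p := by
  have hp : 0 < p := (Fact.out : p.Prime).pos
  rw [← map_frobenius_expand, coeff_map, pow_succ, coeff_expand_mul hp, frobenius_def]

theorem coeff_one_pow_char (f : F[X]) : (f ^ p).coeff 1 = 0 := by
  have hp := (Fact.out : p.Prime)
  rw [← map_frobenius_expand, coeff_map, coeff_expand hp.pos, if_neg hp.not_dvd_one, map_zero]

/-- The `p`-th power moves the coefficient at `X ^ p ^ k` to `X ^ p ^ (k + 1)`, raised to the power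
`p`, just as `t` moves `t^[k] v`. At the ends, `f ^ p` has no linear term and `t^[n] v = 0`. -/
theorem chainEval_pow (n : ℕ) (v : V) (hv : t^[n] v = 0) (f : F[X]) :
    chainEval t n v (f ^ p) = t (chainEval t n v f) := by
  have h : chainEval t n v (f ^ p) =
      ∑ k ∈ Finset.range (n + 1), (f ^ p).coeff (p ^ k) • t^[k] v := by
    rw [chainEval_apply, Finset.sum_range_succ, hv, smul_zero, add_zero]
  rw [h, Finset.sum_range_succ', pow_zero, coeff_one_pow_char, zero_smul, add_zero,
    chainEval_apply, map_sum]
  refine Finset.sum_congr rfl fun k _ => ?_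
  rw [coeff_pow_char, map_smulₛₗ, frobenius_def, Function.iterate_succ_apply']

theorem chainEval_eq_zero (n : ℕ) (v : V) (f : F[X])
    (hf : f ∈ Ideal.span {(X : F[X]) ^ p ^ n}) : chainEval t n v f = 0 := by
  obtain ⟨g, rfl⟩ := Ideal.mem_span_singleton.mp hf
  rw [chainEval_apply]
  refine Finset.sum_eq_zero fun k hk => ?_
  have : p ^ k < p ^ n :=
    Nat.pow_lt_pow_right (Fact.out : p.Prime).one_lt (Finset.mem_range.mp hk)
  rw [coeff_X_pow_mul', if_neg (by omega), zero_smul]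

variable [PerfectRing F p]

/-- Without a linear term only `t^[k] v` with `k ≥ 1` occur; perfectness supplies the `p`-th roots
of coefficients needed to pull `t` out. -/
theorem chainEval_mem_range (n : ℕ) (v : V) (hv : t^[n] v = 0) (f : F[X])
    (hf : f.coeff 1 = 0) : ∃ w, t w = chainEval t n v f := by
  refine ⟨∑ k ∈ Finset.range n, (frobeniusEquiv F p).symm (f.coeff (p ^ (k + 1))) • t^[k] v, ?_⟩
  have h : chainEval t n v f = ∑ k ∈ Finset.range (n + 1), f.coeff (p ^ k) • t^[k] v := by
    rw [chainEval_apply, Finset.sum_range_succ, hv, smul_zero, add_zero]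
  rw [h, Finset.sum_range_succ', pow_zero, hf, zero_smul, add_zero, map_sum]
  refine Finset.sum_congr rfl fun k _ => ?_
  rw [map_smulₛₗ, ← frobeniusEquiv_apply, RingEquiv.apply_symm_apply,
    Function.iterate_succ_apply']

/-- The linear functional `x ↦ f (t x) ^ (1 / p)`. -/
def untwist (f : V →ₗ[F] F) : V →ₗ[F] F where
  toFun x := (frobeniusEquiv F p).symm (f (t x))
  map_add' x y := by rw [map_add, map_add, map_add]
  map_smul' a x := by
    rw [map_smulₛₗ, map_smul, smul_eq_mul, map_mul, ← frobeniusEquiv_apply,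
      RingEquiv.symm_apply_apply]
    rfl

theorem untwist_pow (f : V →ₗ[F] F) (x : V) : untwist t f x ^ p = f (t x) :=
  (frobeniusEquiv F p).apply_symm_apply (f (t x))

theorem untwist_iterate_pow (f : V →ₗ[F] F) (j : ℕ) (x : V) :
    ((untwist t)^[j] f) x ^ p ^ j = f (t^[j] x) := by
  induction j generalizing x with
  | zero => simp
  | succ j ih =>
    rw [Function.iterate_succ_apply', pow_succ', pow_mul, untwist_pow, ih,
      ← Function.iterate_succ_apply]

/-- The additive polynomial whose coefficient at `X ^ p ^ k`, for `k ≤ m`, is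
`f (t^[m - k] x) ^ (1 / p ^ (m - k))`. -/
def chainCoord (m : ℕ) (f : V →ₗ[F] F) : V →ₗ[F] F[X] :=
  ∑ k ∈ Finset.range (m + 1), monomial (p ^ k) ∘ₗ (untwist t)^[m - k] f

theorem chainCoord_apply (m : ℕ) (f : V →ₗ[F] F) (x : V) : chainCoord t m f x =
    ∑ k ∈ Finset.range (m + 1), monomial (p ^ k) (((untwist t)^[m - k] f) x) := by
  simp [chainCoord]

/-- The terms cancel after a shift of index by one. The lowest term for `t x` involves `f (t^[m + 1]
x) = 0`; the highest term of the `p`-th power is a multiple of `X ^ p ^ (m + 1)`. -/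
theorem chainCoord_map (m : ℕ) (f : V →ₗ[F] F) (x : V) (hx : t^[m + 1] x = 0) :
    chainCoord t m f x ^ p - chainCoord t m f (t x) ∈ Ideal.span {(X : F[X]) ^ p ^ (m + 1)} := by
  have h1 : ∀ j, ((untwist t)^[j + 1] f) x ^ p = ((untwist t)^[j] f) (t x) := fun j => by
    rw [Function.iterate_succ_apply', untwist_pow]
  have h2 : ((untwist t)^[m] f) (t x) = 0 := by
    refine eq_zero_of_pow_eq_zero (n := p ^ m) ?_
    rw [untwist_iterate_pow, ← Function.iterate_succ_apply, hx, map_zero]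
  rw [chainCoord_apply, chainCoord_apply, sum_pow_char, Finset.sum_range_succ,
    Finset.sum_range_succ', Nat.sub_zero, h2, map_zero, add_zero]
  have h3 : ∀ k ∈ Finset.range m, monomial (p ^ k) (((untwist t)^[m - k] f) x) ^ p =
      monomial (p ^ (k + 1)) (((untwist t)^[m - (k + 1)] f) (t x)) := fun k hk => by
    have hk := Finset.mem_range.mp hk
    rw [monomial_pow, ← pow_succ, ← h1, show m - (k + 1) + 1 = m - k by omega]
  rw [Finset.sum_congr rfl h3, add_sub_cancel_left, monomial_pow, ← pow_succ,
    ← C_mul_X_pow_eq_monomial]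
  exact Ideal.mul_mem_left _ _ (Ideal.subset_span rfl)

theorem chainEval_chainCoord (m : ℕ) (v : V) (f : V →ₗ[F] F) (x : V) :
    chainEval t (m + 1) v (chainCoord t m f x) =
      ∑ k ∈ Finset.range (m + 1), ((untwist t)^[m - k] f) x • t^[k] v := by
  rw [chainEval_apply]
  refine Finset.sum_congr rfl fun k hk => ?_
  rw [chainCoord_apply, finsetSum_coeff, Finset.sum_eq_single k]
  · rw [coeff_monomial, if_pos rfl]
  · intro i _ hi
    rw [coeff_monomial, if_neg]
    exact fun h => hi (Nat.pow_right_injective (Fact.out : p.Prime).two_le h)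
  · exact fun h => absurd hk h

theorem chainEval_chainCoord_self (m : ℕ) (v : V) (f : V →ₗ[F] F) (hf : f (t^[m] v) = 1)
    (hf' : ∀ j < m, f (t^[j] v) = 0) : chainEval t (m + 1) v (chainCoord t m f v) = v := by
  have hp : p ≠ 0 := (Fact.out : p.Prime).ne_zero
  rw [chainEval_chainCoord, Finset.sum_range_succ', Finset.sum_eq_zero, zero_add, Nat.sub_zero]
  · have : ((untwist t)^[m] f) v = 1 := by
      refine iterateFrobenius_inj F p m ?_
      rw [iterateFrobenius_def, untwist_iterate_pow, hf, map_one]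
    rw [this, one_smul]
    rfl
  · intro k hk
    have hk := Finset.mem_range.mp hk
    have : ((untwist t)^[m - (k + 1)] f) v = 0 := by
      refine eq_zero_of_pow_eq_zero (n := p ^ (m - (k + 1))) ?_
      rw [untwist_iterate_pow, hf' _ (by omega)]
    rw [this, zero_smul]

end Chain

/-! ### The retraction onto `V`, built chain by chain -/

namespace FrobeniusEnvelope

open Polynomial

variable {F : Type*} [Field F] {p : ℕ} [Fact p.Prime] [CharP F p]
variable {V : Type*} [AddCommGroup V] [Module F V] (t : V →ₛₗ[frobenius F p] V)

/-- The endomorphism `e` extends along `ι` to a linear map on the universal algebra that turns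
`p`-th powers into `t` and sends products of nilpotent elements to the range of `t`. -/
def Extends (e : V →ₗ[F] V) : Prop :=
  ∃ π : FrobeniusEnvelope t →ₗ[F] V, (∀ y, π (y ^ p) = t (π y)) ∧
    (∀ y z, IsNilpotent y → IsNilpotent z → ∃ w, t w = π (y * z)) ∧ ∀ x, π (ι t x) = e x

variable {t}

theorem Extends.zero : Extends t 0 :=
  ⟨0, fun y => by simp, fun y z _ _ => ⟨0, by simp⟩, fun x => rfl⟩

theorem Extends.add {e e' : V →ₗ[F] V} (h : Extends t e) (h' : Extends t e') :
    Extends t (e + e') := by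
  obtain ⟨π, h1, h2, h3⟩ := h
  obtain ⟨π', h1', h2', h3'⟩ := h'
  refine ⟨π + π', fun y => ?_, fun y z hy hz => ?_, fun x => ?_⟩
  · rw [LinearMap.add_apply, LinearMap.add_apply, map_add, h1, h1']
  · obtain ⟨w, hw⟩ := h2 y z hy hz
    obtain ⟨w', hw'⟩ := h2' y z hy hz
    exact ⟨w + w', by rw [map_add, hw, hw', LinearMap.add_apply]⟩
  · rw [LinearMap.add_apply, LinearMap.add_apply, h3, h3']

theorem coeff_zero_eq_zero_of_isNilpotent_mk {n : ℕ} (hn : n ≠ 0) (f : F[X])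
    (hf : IsNilpotent (Ideal.Quotient.mk (Ideal.span {(X : F[X]) ^ n}) f)) : f.coeff 0 = 0 := by
  obtain ⟨k, hk⟩ := hf
  rw [← map_pow, Ideal.Quotient.eq_zero_iff_mem, Ideal.mem_span_singleton] at hk
  have := (dvd_pow_self X hn).trans hk
  rw [X_dvd_iff, coeff_zero_eq_eval_zero, eval_pow] at this
  rw [coeff_zero_eq_eval_zero]
  exact eq_zero_of_pow_eq_zero this

variable [PerfectRing F p]

/-- The extension factors through `F[X]/(X^(p^(m+1)))`. Nilpotents there have zero constant term, so
a product of two has no linear term and `chainEval_mem_range` applies. -/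
theorem extends_chain (e : V →ₗ[F] V) (he : ∀ x, e (t x) = t (e x)) (m : ℕ)
    (hm : ∀ x, t^[m + 1] (e x) = 0) (v : V) (hv : t^[m + 1] v = 0) (f : V →ₗ[F] F) :
    Extends t (chainEval t (m + 1) v ∘ₗ chainCoord t m f ∘ₗ e) := by
  let I : Ideal F[X] := Ideal.span {X ^ p ^ (m + 1)}
  let g : FrobeniusEnvelope t →ₐ[F] F[X] ⧸ I :=
    lift t ((Ideal.Quotient.mkₐ F I).toLinearMap ∘ₗ chainCoord t m f ∘ₗ e) fun x => by
      refine (Ideal.Quotient.eq.mpr ?_).symm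
      rw [LinearMap.comp_apply, LinearMap.comp_apply, he]
      exact chainCoord_map t m f (e x) (hm x)
  have hg : ∀ x, g (ι t x) = Ideal.Quotient.mk I (chainCoord t m f (e x)) := fun x =>
    lift_ι t ((Ideal.Quotient.mkₐ F I).toLinearMap ∘ₗ chainCoord t m f ∘ₗ e) _ x
  let δ : (F[X] ⧸ I) →ₗ[F] V :=
    Submodule.liftQ (I.restrictScalars F) (chainEval t (m + 1) v) fun a ha =>
      chainEval_eq_zero t (m + 1) v a ha
  have hδ : ∀ a, δ (Ideal.Quotient.mk I a) = chainEval t (m + 1) v a := fun a => rfl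
  have hI : p ^ (m + 1) ≠ 0 := pow_ne_zero _ (Fact.out : p.Prime).ne_zero
  refine ⟨δ ∘ₗ g.toLinearMap, fun y => ?_, fun y z hy hz => ?_, fun x => ?_⟩
  · obtain ⟨a, ha⟩ := Ideal.Quotient.mk_surjective (g y)
    rw [LinearMap.comp_apply, LinearMap.comp_apply, AlgHom.toLinearMap_apply,
      AlgHom.toLinearMap_apply, map_pow, ← ha, ← map_pow, hδ, hδ, chainEval_pow t _ v hv]
  · obtain ⟨a, ha⟩ := Ideal.Quotient.mk_surjective (g y)
    obtain ⟨b, hb⟩ := Ideal.Quotient.mk_surjective (g z)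
    have ha0 := coeff_zero_eq_zero_of_isNilpotent_mk hI a (ha ▸ hy.map g)
    have hb0 := coeff_zero_eq_zero_of_isNilpotent_mk hI b (hb ▸ hz.map g)
    rw [LinearMap.comp_apply, AlgHom.toLinearMap_apply, map_mul, ← ha, ← hb, ← map_mul, hδ]
    refine chainEval_mem_range t _ v hv _ ?_
    rw [mul_coeff_one, ha0, hb0, zero_mul, mul_zero, add_zero]
  · rw [LinearMap.comp_apply, AlgHom.toLinearMap_apply, hg, hδ]
    rfl

variable (t) in
-- Split a chain of maximal length off the image of `e` and induct on the rank. Working with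
-- idempotents that commute with `t` avoids passing to subspaces.
theorem extends_of_idempotent [Module.Finite F V] (ht : ∃ n, ∀ x, t^[n] x = 0) (r : ℕ) :
    ∀ e : V →ₗ[F] V, (∀ x, e (t x) = t (e x)) → (∀ x, e (e x) = e x) →
      Module.finrank F (LinearMap.range e) ≤ r → Extends t e := by
  induction r with
  | zero =>
    intro e _ _ hr
    have := Submodule.finrank_eq_zero.mp (Nat.le_zero.mp hr)
    rw [LinearMap.range_eq_bot] at this
    exact this ▸ Extends.zero
  | succ r ih =>
    intro e het hee hr
    by_cases he0 : e = 0
    · exact he0 ▸ Extends.zero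
    classical
    have hn : ∃ n, ∀ x, t^[n] (e x) = 0 := ht.imp fun n h x => h _
    -- `m + 1` is the least exponent for which `t^[m + 1]` kills the image of `e`. Maximality is
    -- what lets `chainCoord` respect the relations on that whole image.
    obtain ⟨m, hm⟩ : ∃ m, Nat.find hn = m + 1 := by
      refine Nat.exists_eq_succ_of_ne_zero fun h => he0 ?_
      have := Nat.find_spec hn
      rw [h] at this
      exact LinearMap.ext this
    have h1 : ∀ x, t^[m + 1] (e x) = 0 := hm ▸ Nat.find_spec hn
    have h2 := Nat.find_min hn (m := m) (by omega)
    push Not at h2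
    obtain ⟨x, hx⟩ := h2
    set v := e x with hvx
    have hev : e v = v := hee x
    obtain ⟨f, hf, hf'⟩ := exists_dual_iterate t m v hx (h1 x)
    set q : V →ₗ[F] V := chainEval t (m + 1) v ∘ₗ chainCoord t m f ∘ₗ e with hq
    have hqe : Extends t q := extends_chain e het m h1 v (h1 x) f
    -- Any extendable map commutes with `t`: evaluate `π` on `ι y ^ p = ι (t y)`.
    have hqt : ∀ y, q (t y) = t (q y) := by
      obtain ⟨π, hπ, _, hι⟩ := hqe
      intro y
      rw [← hι, ← hι, ← ι_pow, hπ]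
    have hqv : q v = v := by
      rw [hq, LinearMap.comp_apply, LinearMap.comp_apply, hev]
      exact chainEval_chainCoord_self t m v f hf hf'
    have hit : ∀ g : V →ₗ[F] V, (∀ y, g (t y) = t (g y)) → ∀ (k : ℕ) y,
        g (t^[k] y) = t^[k] (g y) := fun g hg k y =>
      (Function.Semiconj.iterate_right (f := g) hg k) y
    -- The image of `q` lies in the span of the `t^[k] v`. Applied to `q` and to `e`, this gives `q
    -- q = q` and `e q = q`, so `e - q` is idempotent.
    have hfix : ∀ g : V →ₗ[F] V, (∀ y, g (t y) = t (g y)) → g v = v → ∀ y, g (q y) = q y := by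
      intro g hg hgv y
      rw [hq, LinearMap.comp_apply, LinearMap.comp_apply, chainEval_apply, map_sum]
      refine Finset.sum_congr rfl fun k _ => ?_
      rw [map_smul, hit g hg, hgv]
    have hqq := hfix q hqt hqv
    have heq := hfix e het hev
    have hqe' : ∀ y, q (e y) = q y := fun y => by
      rw [hq, LinearMap.comp_apply, LinearMap.comp_apply, LinearMap.comp_apply,
        LinearMap.comp_apply, hee]
    have hidem : ∀ y, (e - q) ((e - q) y) = (e - q) y := fun y => by
      simp only [LinearMap.sub_apply, map_sub, hee, heq, hqe', hqq, sub_self, sub_zero]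
    have hlt : LinearMap.range (e - q) < LinearMap.range e := by
      refine lt_of_le_of_ne ?_ fun h => ?_
      · rintro _ ⟨y, rfl⟩
        refine ⟨(e - q) y, ?_⟩
        simp only [LinearMap.sub_apply, map_sub, hee, heq]
      · have hv : v ∈ LinearMap.range (e - q) := h ▸ ⟨x, rfl⟩
        obtain ⟨y, hy⟩ := hv
        have h0 : v = 0 := by
          rw [← hy, ← hidem, hy, LinearMap.sub_apply, hev, hqv, sub_self]
        refine hx ?_
        rw [h0, iterate_map_zero]
    have := Submodule.finrank_lt_finrank_of_lt hlt
    have hd := ih (e - q) (fun y => by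
      rw [LinearMap.sub_apply, LinearMap.sub_apply, het, hqt, map_sub]) hidem (by omega)
    have := hd.add hqe
    rwa [sub_add_cancel] at this

variable (t) in
/-- For a nilpotent `t`, there is a linear retraction of the universal algebra onto `V` that is
compatible with `p`-th powers. -/
theorem extends_id [Module.Finite F V] (ht : ∃ n, ∀ x, t^[n] x = 0) : Extends t LinearMap.id :=
  extends_of_idempotent t ht _ LinearMap.id (fun _ => rfl) (fun _ => rfl) le_rfl

end FrobeniusEnvelope

/-! ### Recovering `(V, t)` from its universal algebra -/

namespace FrobeniusEnvelope

variable {F : Type*} [Field F] {p : ℕ} [Fact p.Prime] [CharP F p]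
variable {V : Type*} [AddCommGroup V] [Module F V] (t : V →ₛₗ[frobenius F p] V)
variable {W : Type*} [AddCommGroup W] [Module F W] (s : W →ₛₗ[frobenius F p] W)

theorem ι_smul (c : F) (x : V) :
    ι t (c • x) = algebraMap F (FrobeniusEnvelope t) c * ι t x :=
  ((ι t).map_smul c x).trans (Algebra.smul_def c (ι t x))

theorem isNilpotent_ι (ht : ∃ n, ∀ x, t^[n] x = 0) (x : V) : IsNilpotent (ι t x) := by
  obtain ⟨n, hn⟩ := ht
  exact ⟨p ^ n, by rw [ι_iterate_pow, hn, map_zero]⟩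

/-- The augmentation of the universal algebra. -/
def augmentation : FrobeniusEnvelope t →ₐ[F] F :=
  lift t 0 fun x => by simp [(Fact.out : p.Prime).ne_zero]

theorem augmentation_ι (x : V) : augmentation t (ι t x) = 0 :=
  lift_ι t 0 _ x

theorem augmentation_eq_zero {y : FrobeniusEnvelope t} (hy : IsNilpotent y) :
    augmentation t y = 0 :=
  (hy.map (augmentation t)).eq_zero

theorem exists_eq_algebraMap_add_ι_add (ht : ∃ n, ∀ x, t^[n] x = 0) (y : FrobeniusEnvelope t) :
    ∃ c x, ∃ z ∈ nilradical (FrobeniusEnvelope t) ^ 2, y = algebraMap F _ c + ι t x + z := by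
  have hy : y ∈ Algebra.adjoin F (Set.range (ι t)) := adjoin_range_ι t ▸ Algebra.mem_top
  induction hy using Algebra.adjoin_induction with
  | mem y hy =>
    obtain ⟨x, rfl⟩ := hy
    exact ⟨0, x, 0, zero_mem _, by simp⟩
  | algebraMap c => exact ⟨c, 0, 0, zero_mem _, by simp⟩
  | add y y' _ _ hy hy' =>
    obtain ⟨c, x, z, hz, rfl⟩ := hy
    obtain ⟨c', x', z', hz', rfl⟩ := hy'
    exact ⟨c + c', x + x', z + z', add_mem hz hz', by rw [map_add, map_add]; ring⟩
  | mul y y' _ _ hy hy' =>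
    obtain ⟨c, x, z, hz, rfl⟩ := hy
    obtain ⟨c', x', z', hz', rfl⟩ := hy'
    refine ⟨c * c', c • x' + c' • x, ι t x * ι t x' + (z * (algebraMap F _ c' + ι t x' + z') +
      (algebraMap F _ c + ι t x) * z'), ?_, ?_⟩
    · refine add_mem ?_ (add_mem (Ideal.mul_mem_right _ _ hz) (Ideal.mul_mem_left _ _ hz'))
      rw [pow_two]
      exact Ideal.mul_mem_mul (isNilpotent_ι t ht x) (isNilpotent_ι t ht x')
    · rw [map_mul, map_add, ι_smul, ι_smul]
      ring

theorem exists_eq_ι_add (ht : ∃ n, ∀ x, t^[n] x = 0) (y : FrobeniusEnvelope t)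
    (hy : augmentation t y = 0) :
    ∃ x, ∃ z ∈ nilradical (FrobeniusEnvelope t) ^ 2, y = ι t x + z := by
  obtain ⟨c, x, z, hz, rfl⟩ := exists_eq_algebraMap_add_ι_add t ht y
  have hz' : augmentation t z = 0 :=
    augmentation_eq_zero t (mem_nilradical.mp (Ideal.pow_le_self two_ne_zero hz))
  rw [map_add, map_add, augmentation_ι, hz', add_zero, add_zero, AlgHom.commutes] at hy
  refine ⟨x, z, hz, ?_⟩
  have : c = 0 := hy
  rw [this, map_zero, zero_add]

/-- The algebra is commutative and generated by finitely many nilpotent, hence integral, elements.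
-/
theorem finite [Module.Finite F V] (ht : ∃ n, ∀ x, t^[n] x = 0) :
    Module.Finite F (FrobeniusEnvelope t) := by
  let b := Module.finBasis F V
  have hb : Algebra.adjoin F (Set.range fun i => ι t (b i)) = ⊤ := by
    rw [eq_top_iff, ← adjoin_range_ι t, Algebra.adjoin_le_iff]
    rintro _ ⟨x, rfl⟩
    rw [← b.sum_repr x, map_sum]
    refine sum_mem fun i _ => ?_
    rw [ι_smul]
    exact mul_mem (Subalgebra.algebraMap_mem _ _) (Algebra.subset_adjoin (Set.mem_range_self i))
  have hint : ∀ y ∈ Set.range (fun i => ι t (b i)), IsIntegral F y := by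
    rintro _ ⟨i, rfl⟩
    obtain ⟨n, hn⟩ := isNilpotent_ι t ht (b i)
    exact IsIntegral.of_pow (n := n + 1) n.succ_pos
      (by rw [pow_succ, hn, zero_mul]; exact isIntegral_zero)
  have h := Algebra.finite_adjoin_of_finite_of_isIntegral
    (Set.finite_range fun i => ι t (b i)) hint
  rw [hb] at h
  exact Module.Finite.of_surjective (Subalgebra.topEquiv (R := F)).toLinearMap
    (Subalgebra.topEquiv (R := F)).surjective

variable {t s}

theorem finite_of_algEquiv [Module.Finite F V] (ht : ∃ n, ∀ x, t^[n] x = 0)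
    (φ : FrobeniusEnvelope t ≃ₐ[F] FrobeniusEnvelope s) : Module.Finite F W := by
  have := finite t ht
  have := Module.Finite.equiv φ.toLinearEquiv
  exact Module.Finite.of_injective (ι s) (ι_injective s)

/-- Every element is a scalar plus a nilpotent, and the augmentation kills `ι s x`, so `ι s x` is
nilpotent. The nilradical is nilpotent by finiteness, which bounds the exponent uniformly. -/
theorem nilpotent_of_algEquiv [Module.Finite F V] (ht : ∃ n, ∀ x, t^[n] x = 0)
    (φ : FrobeniusEnvelope t ≃ₐ[F] FrobeniusEnvelope s) : ∃ n, ∀ x, s^[n] x = 0 := by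
  have := finite t ht
  have := Module.Finite.equiv φ.toLinearEquiv
  have : IsNoetherianRing (FrobeniusEnvelope s) := IsNoetherianRing.of_finite F _
  obtain ⟨n, hn⟩ := IsNoetherianRing.isNilpotent_nilradical (FrobeniusEnvelope s)
  have hnil : ∀ x, ι s x ∈ nilradical (FrobeniusEnvelope s) := by
    intro x
    obtain ⟨c, a, z, hz, h⟩ := exists_eq_algebraMap_add_ι_add t ht (φ.symm (ι s x))
    have h' : IsNilpotent (ι t a + z) :=
      add_mem (S := Ideal (FrobeniusEnvelope t)) (s := nilradical (FrobeniusEnvelope t))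
        (isNilpotent_ι t ht a) (Ideal.pow_le_self two_ne_zero hz)
    have h2 : ι s x = algebraMap F _ c + φ (ι t a + z) := by
      rw [← φ.apply_symm_apply (ι s x), h, add_assoc, map_add, AlgEquiv.commutes]
    have h3 := h'.map φ
    have hc : c = 0 := by
      have := augmentation_ι s x
      rw [h2, map_add, augmentation_eq_zero s h3, add_zero, AlgHom.commutes] at this
      exact this
    rw [h2, hc, map_zero, zero_add]
    exact h3
  refine ⟨n, fun x => ι_injective s ?_⟩
  rw [← ι_iterate_pow, map_zero]
  have hle : n ≤ p ^ n := (Nat.lt_pow_self (Fact.out : p.Prime).one_lt).le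
  have := Ideal.pow_le_pow_right hle (Ideal.pow_mem_pow (hnil x) (p ^ n))
  rw [hn] at this
  exact this

/-- A Nakayama argument: iterating `W = f(V) + s(W)` gives `W = f(V) + s^k(W)` for all `k`. -/
theorem surjective_of_forall_exists_add (hs : ∃ n, ∀ x, s^[n] x = 0) (f : V →ₗ[F] W)
    (hf : ∀ x, f (t x) = s (f x)) (h : ∀ w, ∃ x w', w = f x + s w') : Function.Surjective f := by
  obtain ⟨n, hn⟩ := hs
  have key : ∀ k w, ∃ x w', w = f x + s^[k] w' := by
    intro k
    induction k with
    | zero => exact fun w => ⟨0, w, by simp⟩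
    | succ k ih =>
      intro w
      obtain ⟨x, w', rfl⟩ := ih w
      obtain ⟨x', w'', rfl⟩ := h w'
      refine ⟨x + t^[k] x', w'', ?_⟩
      have hk : f (t^[k] x') = s^[k] (f x') :=
        (Function.Semiconj.iterate_right (f := f) hf k) x'
      rw [iterate_map_add, map_add, hk, Function.iterate_succ_apply, add_assoc]
  intro w
  obtain ⟨x, w', rfl⟩ := key n w
  exact ⟨x, by rw [hn, add_zero]⟩

variable [PerfectRing F p]

theorem exists_surjective_of_algEquiv [Module.Finite F W] (ht : ∃ n, ∀ x, t^[n] x = 0)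
    (hs : ∃ n, ∀ x, s^[n] x = 0) (φ : FrobeniusEnvelope t ≃ₐ[F] FrobeniusEnvelope s) :
    ∃ f : V →ₗ[F] W, (∀ x, f (t x) = s (f x)) ∧ Function.Surjective f := by
  obtain ⟨π, hπ, hπ', hι⟩ := extends_id s hs
  let f : V →ₗ[F] W := π ∘ₗ φ.toLinearMap ∘ₗ ι t
  have hf : ∀ x, f x = π (φ (ι t x)) := fun x => rfl
  have hft : ∀ x, f (t x) = s (f x) := fun x => by rw [hf, hf, ← ι_pow, map_pow, hπ]
  refine ⟨f, hft, surjective_of_forall_exists_add hs f hft fun w => ?_⟩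
  have hsq : ∀ z ∈ nilradical (FrobeniusEnvelope t) ^ 2, ∃ w', s w' = π (φ z) := by
    intro z hz
    rw [pow_two] at hz
    refine Submodule.mul_induction_on hz (fun a ha b hb => ?_) fun a b ha hb => ?_
    · rw [map_mul]
      exact hπ' _ _ (IsNilpotent.map ha φ) (IsNilpotent.map hb φ)
    · obtain ⟨w1, h1⟩ := ha
      obtain ⟨w2, h2⟩ := hb
      exact ⟨w1 + w2, by rw [map_add, h1, h2, map_add, map_add]⟩
  have hnil : IsNilpotent (φ.symm (ι s w)) := (isNilpotent_ι s hs w).map φ.symm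
  -- Applying `π ∘ φ` to this decomposition gives `w = f x + π (φ z)`, whose last term is in the
  -- range of `s`.
  obtain ⟨x, z, hz, h⟩ := exists_eq_ι_add t ht _ (augmentation_eq_zero t hnil)
  obtain ⟨w', hw'⟩ := hsq z hz
  refine ⟨x, w', ?_⟩
  rw [hw', hf, ← map_add, ← map_add, ← h, AlgEquiv.apply_symm_apply, hι]
  rfl

/-- A finite-dimensional vector space with a nilpotent Frobenius-semilinear endomorphism, over a
perfect field, is determined by its universal algebra. -/
theorem exists_linearEquiv_of_algEquiv [Module.Finite F V] (ht : ∃ n, ∀ x, t^[n] x = 0)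
    (φ : FrobeniusEnvelope t ≃ₐ[F] FrobeniusEnvelope s) :
    ∃ e : V ≃ₗ[F] W, ∀ x, e (t x) = s (e x) := by
  have hW := finite_of_algEquiv ht φ
  have hs := nilpotent_of_algEquiv ht φ
  obtain ⟨f, hf, hfs⟩ := exists_surjective_of_algEquiv ht hs φ
  obtain ⟨g, _, hgs⟩ := exists_surjective_of_algEquiv hs ht φ.symm
  have h : Module.finrank F V = Module.finrank F W :=
    le_antisymm (LinearMap.finrank_le_finrank_of_surjective hgs)
      (LinearMap.finrank_le_finrank_of_surjective hfs)
  have hinj : Function.Injective f :=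
    (LinearMap.injective_iff_surjective_of_finrank_eq_finrank h).mpr hfs
  exact ⟨LinearEquiv.ofBijective f ⟨hinj, hfs⟩, hf⟩

end FrobeniusEnvelope

/-! ### The largest commutative quotient of `u(L)` -/

namespace RestrictedLieAlgebra

attribute [local instance 100] LieRing.ofAssociativeRing

variable (F : Type*) [Field F] (p : ℕ)
variable (L : Type*) [LieRing L] [LieAlgebra F L] [RestrictedLieAlgebra F p L]

/-- The canonical map from `L` to its restricted enveloping algebra. -/
def toEnveloping : L →ₗ⁅F⁆ RestrictedEnvelopingAlgebra F p L :=
  (RingQuot.mkAlgHom F (EnvelopingRel F p L)).toLieHom.comp (UniversalEnvelopingAlgebra.ι F)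

theorem toEnveloping_pmap (x : L) :
    toEnveloping F p L (pmap F p x) = toEnveloping F p L x ^ p := by
  have := RingQuot.mkAlgHom_rel F (EnvelopingRel.pow (F := F) (p := p) x)
  rw [map_pow] at this
  exact this.symm

variable {F p L}

theorem envelopingAlgebra_algHom_ext {C : Type*} [Ring C] [Algebra F C]
    {f g : RestrictedEnvelopingAlgebra F p L →ₐ[F] C}
    (h : ∀ x, f (toEnveloping F p L x) = g (toEnveloping F p L x)) : f = g := by
  refine RingQuot.ringQuot_ext' F f g (UniversalEnvelopingAlgebra.hom_ext F (LieHom.ext fun x => ?_))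
  exact h x

/-- A Lie algebra homomorphism into an associative algebra that turns the `p`-map into the `p`-th
power extends to the restricted enveloping algebra. -/
def envelopingLift {C : Type*} [Ring C] [Algebra F C] (g : L →ₗ⁅F⁆ C)
    (hg : ∀ x, g (pmap F p x) = g x ^ p) : RestrictedEnvelopingAlgebra F p L →ₐ[F] C :=
  RingQuot.liftAlgHom F ⟨UniversalEnvelopingAlgebra.lift F g, by
    rintro _ _ ⟨x⟩
    rw [map_pow, UniversalEnvelopingAlgebra.lift_ι_apply, UniversalEnvelopingAlgebra.lift_ι_apply,
      hg]⟩

theorem envelopingLift_toEnveloping {C : Type*} [Ring C] [Algebra F C] (g : L →ₗ⁅F⁆ C)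
    (hg : ∀ x, g (pmap F p x) = g x ^ p) (x : L) :
    envelopingLift g hg (toEnveloping F p L x) = g x := by
  refine (RingQuot.liftAlgHom_mkAlgHom_apply _ _ _ _).trans ?_
  exact UniversalEnvelopingAlgebra.lift_ι_apply F g x

theorem lie_quotient_derivedP (x y : L ⧸ derivedP F p L) : ⁅x, y⁆ = 0 := by
  obtain ⟨a, rfl⟩ : ∃ a, quotientHom F (derivedP F p L) a = x :=
    LieSubmodule.Quotient.surjective_mk' _ x
  obtain ⟨b, rfl⟩ : ∃ b, quotientHom F (derivedP F p L) b = y :=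
    LieSubmodule.Quotient.surjective_mk' _ y
  rw [← LieHom.map_lie]
  refine (LieSubmodule.Quotient.mk_eq_zero').mpr ?_
  exact subset_restrictedClosure F p _
    (LieSubmodule.lie_mem_lie (LieSubmodule.mem_top a) (LieSubmodule.mem_top b))

variable [Fact p.Prime]

theorem jacobsonTerm_eq_zero {M : Type*} [LieRing M] [LieAlgebra F M]
    (h : ∀ x y : M, ⁅x, y⁆ = 0) (i : ℕ) (x y : M) :
    jacobsonTerm F p i x y = 0 := by
  have had : ∀ x, (LieAlgebra.ad F M x : Module.End F M) = 0 := fun x =>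
    LinearMap.ext fun y => h x y
  have hp : p - 1 ≠ 0 := by have := (Fact.out : p.Prime).two_le; omega
  rw [jacobsonTerm, had, had, map_zero, mul_zero, add_zero, zero_pow hp, Polynomial.coeff_zero,
    LinearMap.zero_apply, smul_zero]

variable (F p) in
/-- The `p`-map of an abelian restricted Lie algebra, as a Frobenius-semilinear map. -/
def semilinearPMap [CharP F p] (h : ∀ x y : L, ⁅x, y⁆ = 0) : L →ₛₗ[frobenius F p] L where
  toFun := pmap F p
  map_add' x y := by
    rw [pmap_add, Finset.sum_eq_zero fun i _ => jacobsonTerm_eq_zero h i x y, add_zero]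
  map_smul' a x := pmap_smul a x

/-- The kernel on `L` contains all brackets, as `C` is commutative, and is closed under the `p`-map,
as `g` turns it into the `p`-th power. -/
theorem derivedP_le_ker {C : Type*} [CommRing C] [Algebra F C]
    (g : RestrictedEnvelopingAlgebra F p L →ₐ[F] C) (x : L) (hx : x ∈ derivedP F p L) : g (toEnveloping F p L x) = 0 := by
  let k : L →ₗ⁅F⁆ C := g.toLieHom.comp (toEnveloping F p L)
  have hk : ∀ x y, k ⁅x, y⁆ = 0 := fun x y => by
    rw [LieHom.map_lie, LieRing.of_associative_ring_bracket, mul_comm, sub_self]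
  have h := (mem_restrictedClosure F p _ x).mp hx k.ker.toLieSubalgebra ?_ ?_
  · exact LieHom.mem_ker.mp h
  · intro y hy
    have : (⁅(⊤ : LieIdeal F L), (⊤ : LieIdeal F L)⁆ : LieIdeal F L) ≤ k.ker := by
      rw [LieSubmodule.lie_le_iff]
      intro a _ b _
      exact LieHom.mem_ker.mpr (hk a b)
    exact this hy
  · intro y hy
    have hy : g (toEnveloping F p L y) = 0 := hy
    change g (toEnveloping F p L (pmap F p y)) = 0
    rw [toEnveloping_pmap, map_pow, hy, zero_pow (Fact.out : p.Prime).ne_zero]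

section Abelianization

variable [CharP F p]

variable (F p L) in
/-- The `p`-map of `L / L'_p`, as a Frobenius-semilinear map. -/
abbrev quotientSemilinearPMap :
    (L ⧸ derivedP F p L) →ₛₗ[frobenius F p] (L ⧸ derivedP F p L) :=
  semilinearPMap F p lie_quotient_derivedP

variable (F p L) in
/-- The projection of `u(L)` to the universal commutative algebra over `L / L'_p`. -/
def envelopingProj :
    RestrictedEnvelopingAlgebra F p L →ₐ[F] FrobeniusEnvelope (quotientSemilinearPMap F p L) :=
  envelopingLift
    { toLinearMap := FrobeniusEnvelope.ι (quotientSemilinearPMap F p L) ∘ₗ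
        (quotientHom F (derivedP F p L)).toLinearMap
      map_lie' := fun {x y} => by
        rw [LieRing.of_associative_ring_bracket, mul_comm, sub_self]
        change FrobeniusEnvelope.ι (quotientSemilinearPMap F p L)
          (quotientHom F (derivedP F p L) ⁅x, y⁆) = 0
        rw [LieHom.map_lie, lie_quotient_derivedP, map_zero] }
    fun x => (FrobeniusEnvelope.ι_pow (quotientSemilinearPMap F p L)
      (quotientHom F (derivedP F p L) x)).symm

theorem envelopingProj_toEnveloping (x : L) : envelopingProj F p L (toEnveloping F p L x) =
    FrobeniusEnvelope.ι (quotientSemilinearPMap F p L) (quotientHom F (derivedP F p L) x) :=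
  envelopingLift_toEnveloping _ _ x

variable {C : Type*} [CommRing C] [Algebra F C]

theorem exists_comp_envelopingProj (g : RestrictedEnvelopingAlgebra F p L →ₐ[F] C) :
    ∃ k : FrobeniusEnvelope (quotientSemilinearPMap F p L) →ₐ[F] C,
      k.comp (envelopingProj F p L) = g := by
  let k : (L ⧸ derivedP F p L) →ₗ[F] C :=
    Submodule.liftQ (derivedP F p L).toSubmodule
      (g.toLinearMap ∘ₗ (toEnveloping F p L).toLinearMap) fun x hx => derivedP_le_ker g x hx
  have hk : ∀ x, k (quotientHom F (derivedP F p L) x) = g (toEnveloping F p L x) := fun x => rfl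
  have hkt : ∀ x, k (quotientSemilinearPMap F p L x) = k x ^ p := by
    intro q
    obtain ⟨x, rfl⟩ : ∃ x, quotientHom F (derivedP F p L) x = q :=
      LieSubmodule.Quotient.surjective_mk' _ q
    rw [hk, ← map_pow, ← toEnveloping_pmap]
    exact hk _
  refine ⟨FrobeniusEnvelope.lift _ k hkt, envelopingAlgebra_algHom_ext fun x => ?_⟩
  rw [AlgHom.comp_apply, envelopingProj_toEnveloping, FrobeniusEnvelope.lift_ι, hk]

theorem envelopingProj_epi {f g : FrobeniusEnvelope (quotientSemilinearPMap F p L) →ₐ[F] C}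
    (h : f.comp (envelopingProj F p L) = g.comp (envelopingProj F p L)) : f = g := by
  refine FrobeniusEnvelope.algHom_ext _ fun q => ?_
  obtain ⟨x, rfl⟩ : ∃ x, quotientHom F (derivedP F p L) x = q :=
    LieSubmodule.Quotient.surjective_mk' _ q
  rw [← envelopingProj_toEnveloping]
  exact AlgHom.congr_fun h _

/-- Both algebras are universal among commutative quotients, so `φ` and its inverse descend to
mutually inverse maps. -/
theorem nonempty_algEquiv_frobeniusEnvelope
    {H : Type*} [LieRing H] [LieAlgebra F H] [RestrictedLieAlgebra F p H]
    (φ : RestrictedEnvelopingAlgebra F p L ≃ₐ[F] RestrictedEnvelopingAlgebra F p H) :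
    Nonempty (FrobeniusEnvelope (quotientSemilinearPMap F p L) ≃ₐ[F]
      FrobeniusEnvelope (quotientSemilinearPMap F p H)) := by
  obtain ⟨f, hf⟩ := exists_comp_envelopingProj ((envelopingProj F p H).comp φ.toAlgHom)
  obtain ⟨g, hg⟩ := exists_comp_envelopingProj ((envelopingProj F p L).comp φ.symm.toAlgHom)
  have hf' : ∀ y, f (envelopingProj F p L y) = envelopingProj F p H (φ y) := AlgHom.congr_fun hf
  have hg' : ∀ y, g (envelopingProj F p H y) = envelopingProj F p L (φ.symm y) :=
    AlgHom.congr_fun hg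
  refine ⟨AlgEquiv.ofAlgHom f g ?_ ?_⟩
  · refine envelopingProj_epi (AlgHom.ext fun y => ?_)
    rw [AlgHom.comp_apply, AlgHom.comp_apply, hg', hf', AlgEquiv.apply_symm_apply]
    rfl
  · refine envelopingProj_epi (AlgHom.ext fun y => ?_)
    rw [AlgHom.comp_apply, AlgHom.comp_apply, hf', hg', AlgEquiv.symm_apply_apply]
    rfl

theorem IsPNilpotent.quotient (hL : IsPNilpotent F p L) :
    ∃ n, ∀ x, (quotientSemilinearPMap F p L)^[n] x = 0 := by
  obtain ⟨n, hn⟩ := hL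
  refine ⟨n, fun q => ?_⟩
  obtain ⟨x, rfl⟩ : ∃ x, quotientHom F (derivedP F p L) x = q :=
    LieSubmodule.Quotient.surjective_mk' _ q
  have h : ∀ k, (quotientSemilinearPMap F p L)^[k] (quotientHom F (derivedP F p L) x) =
      quotientHom F (derivedP F p L) ((pmap F p)^[k] x) := by
    intro k
    induction k with
    | zero => rfl
    | succ k ih =>
      rw [Function.iterate_succ_apply', Function.iterate_succ_apply', ih]
      rfl
  rw [h, hn, map_zero]

end Abelianization

end RestrictedLieAlgebra

end

theorem mainTheorem5 {F : Type*} [Field F] [PerfectField F] (p : ℕ) [Fact p.Prime] [CharP F p]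
    {L : Type*} [LieRing L] [LieAlgebra F L] [RestrictedLieAlgebra F p L] [Module.Finite F L]
    (hL : RestrictedLieAlgebra.IsPNilpotent F p L)
    {H : Type*} [LieRing H] [LieAlgebra F H] [RestrictedLieAlgebra F p H]
    (hLH : Nonempty (RestrictedLieAlgebra.RestrictedEnvelopingAlgebra F p L ≃ₐ[F]
      RestrictedLieAlgebra.RestrictedEnvelopingAlgebra F p H)) :
    ∃ e : (L ⧸ RestrictedLieAlgebra.derivedP F p L) ≃ₗ⁅F⁆
        (H ⧸ RestrictedLieAlgebra.derivedP F p H),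
      ∀ x, e (RestrictedLieAlgebra.pmap F p x) = RestrictedLieAlgebra.pmap F p (e x) := by
  obtain ⟨φ⟩ := hLH
  obtain ⟨ψ⟩ := RestrictedLieAlgebra.nonempty_algEquiv_frobeniusEnvelope φ
  have : Module.Finite F (L ⧸ RestrictedLieAlgebra.derivedP F p L) :=
    Module.Finite.quotient F (RestrictedLieAlgebra.derivedP F p L).toSubmodule
  obtain ⟨e, he⟩ := FrobeniusEnvelope.exists_linearEquiv_of_algEquiv hL.quotient ψ
  -- Both quotients are abelian, so any linear map respects the brackets.
  refine ⟨{ e with map_lie' := fun {x y} => ?_ }, he⟩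
  change e ⁅x, y⁆ = ⁅e x, e y⁆
  rw [RestrictedLieAlgebra.lie_quotient_derivedP, RestrictedLieAlgebra.lie_quotient_derivedP,
    map_zero]
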